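/- **Programs.** A nondeterministic recursive probabilistic program $W$ is given by its control-flow graph: a finite set $F$ of function names, a finite set $V_r$ of sampling variables and, for each $f\in F$, a finite set $L_f$ of labels, a finite set $V_f$ of program variables, an initial label $\ell^f_{\mathrm{in}}$ and a terminal label $\ell^f_{\mathrm{out}}\neq\ell^f_{\mathrm{in}}$. Variables hold integers; $\mathrm{Val}_V=\mathbb Z^V$ is the set of valuations over $V$. Every non-terminal label $\ell\in L_f$ is of exactly one of four kinds: (a) *assignment*, with one transition $(\ell,u,\ell')$, where $u:\mathrm{Val}_{V_f}\times\mathrm{Val}_{V_r}\to\mathrm{Val}_{V_f}$; (c) *call*, with one transition $(\ell,(g,v),\ell')$, where $g\in F$ and $v:\mathrm{Val}_{V_f}\to\mathrm{Val}_{V_g}$; (b) *branching*, with two transitions $(\ell,\phi,\ell_1)$, $(\ell,\neg\phi,\ell_2)$, where $\phi$ is a propositional arithmetic predicate over $V_f$; (d) *nondeterministic*, with a then-transition $(\ell,\star,\ell_1)$ and an else-transition $(\ell,\star,\ell_2)$. A sampling function $\Upsilon$ assigns to each $r\in V_r$ a probability distribution on $\mathbb Z$, and $\overline\Upsilon(\mu)=\prod_{r\in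 V_r}\Upsilon(r)(\mu(r))$ for $\mu\in\mathrm{Val}_{V_r}$. **Semantics.** A stack element is a triple $\mathfrak c=(f,\ell,\nu)$ with $f\in F$, $\ell\in L_f$, $\nu\in\mathrm{Val}_{V_f}$; it is terminal if $\ell=\ell^f_{\mathrm{out}}$. A configuration is a finite word of non-terminal stack elements (first letter = top of the stack); $\varepsilon$ is the empty one. The program is executed as a Markov decision process whose states are the pairs $(w,\mu)$ of a configuration $w$ and a valuation $\mu\in\mathrm{Val}_{V_r}$, with actions $\tau,\mathbf{th},\mathbf{el}$. In each step a fresh $\mu'$ is drawn with probability $\overline\Upsilon(\mu')$, and a configuration $(f,\ell,\nu)\cdot w$ is replaced by: $(f,\ell',u(\nu,\mu'))\cdot w$ (assignment); $(g,\ell^g_{\mathrm{in}},v(\nu))\cdot(f,\ell',\nu)\cdot w$ (call); $(f,\ell_1,\nu)\cdot w$ if $\nu\models\phi$ and $(f,\ell_2,\nu)\cdot w$ otherwise (branching), all three under the action $\tau$; $(f,\ell_1,\nu)\cdot w$ under $\mathbf{th}$ and $(f,\ell_2,\nu)\cdot w$ under $\mathbf{el}$ (nondeterministic). Here terminal stack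 elements are deleted from the new word, and $\varepsilon$ stays $\varepsilon$ under every action. All other transition probabilities are $0$. An action is enabled at a state if its transition probabilities from that state sum to $1$. A history is a non-empty finite sequence of states in which each consecutive pair has positive transition probability under some action. A scheduler $\sigma$ maps every history to a probability distribution on the actions enabled at its last state. Together with a non-terminal stack element $\mathfrak c$ it determines a Markov chain on histories started at the one-state history $(\mathfrak c,\mathbf 0)$, with law $\mathbb P^\sigma_{\mathfrak c}$ and expectation $\mathbb E^\sigma_{\mathfrak c}$. The termination time $T\in\{0,1,2,\dots\}\cup\{\infty\}$ is the first time at which the configuration is $\varepsilon$ ($\infty$ if there is none). Put $\overline T(\mathfrak c)=\sup_\sigma\mathbb E^\sigma_{\mathfrak c}(T)$ if $\mathfrak c$ is non-terminal, and $\overline T(\mathfrak c)=0$ if $\mathfrak c$ is terminal. **Ranking measure functions.** A function $h$ from stack elements to $[0,\infty]$ is a *ranking measure function* if there is $\epsilon\in(0,\infty)$ such that $h(f,\ell^f_{\mathrm{out}},\nu)=0$ for all $f,\nu$ and, for all stack elements $(f,\ell,\nu)$ with $\ell\neq\ell^f_{\mathrm{out}}$, $$\epsilon+N(f,\ell,\nu)\le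 h(f,\ell,\nu),$$ where (with $0\cdot\infty=0$) $N(f,\ell,\nu)$ is: $\sum_{\mu}\overline\Upsilon(\mu)\,h(f,\ell',u(\nu,\mu))$ for an assignment label; $h(g,\ell^g_{\mathrm{in}},v(\nu))+h(f,\ell',\nu)$ for a call label; $h(f,\ell_1,\nu)$ if $\nu\models\phi$ and $h(f,\ell_2,\nu)$ otherwise for a branching label; $\max\{h(f,\ell_1,\nu),h(f,\ell_2,\nu)\}$ for a nondeterministic label. A ranking measure function $h$ is *conditionally difference-bounded* with constants $\delta,\zeta\in(0,\infty)$ if for all $(f,\ell,\nu)$ with $\ell\neq\ell^f_{\mathrm{out}}$ and $h(f,\ell,\nu)<\infty$, $$h(f,\ell,\nu)\le\delta+N(f,\ell,\nu),$$ and, when $\ell$ is an assignment label, also $$\sum_{\mu}\overline\Upsilon(\mu)\,\bigl|h(f,\ell',u(\nu,\mu))-h(f,\ell,\nu)\bigr|\le\zeta .$$ **Theorem.** Let $W$ be a nondeterministic recursive probabilistic program, $\Upsilon$ a sampling function, and $h$ a conditionally difference-bounded ranking measure function with constants $\delta,\zeta\in(0,\infty)$. Then for every stack element $\mathfrak c$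 with $h(\mathfrak c)<\infty$, $$\overline T(\mathfrak c)\ \ge\ \frac{h(\mathfrak c)}{\delta}.$$ -/

import Mathlib

open scoped ENNReal NNReal

namespace RecProb

/-! ### Expressions, predicates, control-flow graphs -/

/-- Valuations over a set `V` of integer variables. -/
abbrev Val (V : Type) : Type := V → ℤ

/-- Arithmetic expressions over `V`. No expression syntax is fixed: an expression is given by its
(everywhere defined, integer-valued) evaluation. -/
abbrev ArithExpr (V : Type) : Type := Val V → ℤ

/-- Propositional arithmetic predicates over `V`. -/
inductive Pred (V : Type) : Type
  | lt (e e' : ArithExpr V) : Pred V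
  | le (e e' : ArithExpr V) : Pred V
  | gt (e e' : ArithExpr V) : Pred V
  | ge (e e' : ArithExpr V) : Pred V
  | or (φ ψ : Pred V) : Pred V
  | and (φ ψ : Pred V) : Pred V
  | not (φ : Pred V) : Pred V

/-- The satisfaction relation `ν ⊨ φ`. -/
def Pred.Sat {V : Type} (ν : Val V) : Pred V → Prop
  | .lt e e' => e ν < e' ν
  | .le e e' => e ν ≤ e' ν
  | .gt e e' => e ν > e' ν
  | .ge e e' => e ν ≥ e' ν
  | .or φ ψ => φ.Sat ν ∨ ψ.Sat ν
  | .and φ ψ => φ.Sat ν ∧ ψ.Sat ν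
  | .not φ => ¬ φ.Sat ν

/-- The transitions leaving one non-terminal label of the function `f`. The constructor is the
kind of the label (assignment, call, branching, nondeterministic).
* `assign u ℓ'`: the only triple is `(ℓ, u, ℓ')`, with update function `u`;
* `call g v ℓ'`: the only triple is `(ℓ, (g, v), ℓ')`, with value-passing function `v`;
* `branch φ ℓ₁ ℓ₂`: the triples are `(ℓ, φ, ℓ₁)` and `(ℓ, ¬φ, ℓ₂)`;
* `nondet ℓ₁ ℓ₂`: the triples are `(ℓ, ⋆, ℓ₁)` (then) and `(ℓ, ⋆, ℓ₂)` (else). -/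
inductive Transitions (F : Type) (Vr : Type) (PVar : F → Type) (Label : F → Type) (f : F) : Type
  | assign (u : Val (PVar f) → Val Vr → Val (PVar f)) (ℓ' : Label f)
  | call (g : F) (v : Val (PVar f) → Val (PVar g)) (ℓ' : Label f)
  | branch (φ : Pred (PVar f)) (ℓ₁ ℓ₂ : Label f)
  | nondet (ℓ₁ ℓ₂ : Label f)

/-- The control-flow graph of a nondeterministic recursive probabilistic program. -/
structure CFG where
  /-- function names -/
  F : Type
  /-- sampling variables -/
  Vr : Type
  /-- labels of each function -/
  Label : F → Type
  /-- program variables of each function -/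
  PVar : F → Type
  [finiteF : Finite F]
  [fintypeVr : Fintype Vr]
  [finiteLabel : ∀ f, Finite (Label f)]
  [finitePVar : ∀ f, Finite (PVar f)]
  /-- initial label -/
  lin : ∀ f, Label f
  /-- terminal label -/
  lout : ∀ f, Label f
  /-- the body of a function is not empty, so a call starts in a non-terminal label -/
  lin_ne_lout : ∀ f, lin f ≠ lout f
  /-- the transitions leaving each non-terminal label -/
  trans : ∀ (f : F) (ℓ : Label f), ℓ ≠ lout f → Transitions F Vr PVar Label f

attribute [instance] CFG.finiteF CFG.fintypeVr CFG.finiteLabel CFG.finitePVar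

/-- Stack elements `(f, ℓ, ν)`. -/
@[ext]
structure StackElem (W : CFG) where
  fn : W.F
  lb : W.Label fn
  val : Val (W.PVar fn)

/-- A stack element is terminal if its label is the terminal label of its function. -/
def StackElem.Terminal {W : CFG} (c : StackElem W) : Prop := c.lb = W.lout c.fn

/-- Non-terminal stack elements. -/
abbrev NTElem (W : CFG) : Type := {c : StackElem W // ¬ c.Terminal}

/-- Configurations: finite words of non-terminal stack elements, the top of the stack first. -/
abbrev Config (W : CFG) : Type := List (NTElem W)

open Classical in
/-- `c · w` if `c` is non-terminal, and `w` if `c` is terminal. -/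
noncomputable def push {W : CFG} (c : StackElem W) (w : Config W) : Config W :=
  if h : c.Terminal then w else ⟨c, h⟩ :: w

/-- Sampling functions. -/
abbrev Sampling (W : CFG) : Type := W.Vr → PMF ℤ

/-- The product distribution on valuations of the sampling variables. -/
noncomputable def sampProb {W : CFG} (Υ : Sampling W) (μ : Val W.Vr) : ℝ≥0∞ :=
  ∏ r, Υ r (μ r)

/-! ### The Markov decision process -/

/-- States of the MDP: the current configuration, and the sampling of the previous step. -/
abbrev State (W : CFG) : Type := Config W × Val W.Vr

/-- Actions: no nondeterminism, then-branch, else-branch. -/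
inductive Act : Type
  | tau
  | th
  | el

instance : Fintype Act :=
  ⟨⟨[Act.tau, Act.th, Act.el], by simp⟩, by rintro (_ | _ | _) <;> simp⟩

open Classical in
/-- The next configuration, as a function of the valuation sampled in the step;
`none` if the action is not available. -/
noncomputable def next {W : CFG} : Config W → Act → Option (Val W.Vr → Config W)
  | [], _ => some fun _ => []
  | ⟨⟨f, ℓ, ν⟩, h⟩ :: w, a =>
    match W.trans f ℓ h, a with
    | .assign u ℓ', .tau => some fun μ' => push ⟨f, ℓ', u ν μ'⟩ w
    | .call g v ℓ', .tau => some fun _ => push ⟨g, W.lin g, v ν⟩ (push ⟨f, ℓ', ν⟩ w)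
    | .branch φ ℓ₁ ℓ₂, .tau => some fun _ => push ⟨f, if φ.Sat ν then ℓ₁ else ℓ₂, ν⟩ w
    | .nondet ℓ₁ _, .th => some fun _ => push ⟨f, ℓ₁, ν⟩ w
    | .nondet _ ℓ₂, .el => some fun _ => push ⟨f, ℓ₂, ν⟩ w
    | _, _ => none

open Classical in
/-- The probability transition function of the MDP. -/
noncomputable def transProb {W : CFG} (Υ : Sampling W) (s : State W) (a : Act) (s' : State W) :
    ℝ≥0∞ :=
  match next s.1 a with
  | none => 0
  | some G => if s'.1 = G s'.2 then sampProb Υ s'.2 else 0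

/-- The action `a` is enabled at the state `s`. -/
def Enabled {W : CFG} (Υ : Sampling W) (s : State W) (a : Act) : Prop :=
  ∑' s', transProb Υ s a s' = 1

/-- Histories: non-empty finite words of states whose consecutive letters are connected by a
transition of positive probability. -/
abbrev History {W : CFG} (Υ : Sampling W) : Type :=
  {l : List (State W) // l ≠ [] ∧ l.IsChain fun s s' => ∃ a, 0 < transProb Υ s a s'}

/-- The last state of a history. -/
def History.last {W : CFG} {Υ : Sampling W} (ρ : History Υ) : State W := ρ.1.getLast ρ.2.1

/-- The history consisting of one state. -/
def History.single {W : CFG} (Υ : Sampling W) (s : State W) : History Υ :=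
  ⟨[s], List.cons_ne_nil _ _, List.isChain_singleton _⟩

/-- Schedulers map every history to a distribution over the actions enabled at its last state. -/
structure Scheduler {W : CFG} (Υ : Sampling W) where
  dist : History Υ → PMF Act
  enabled : ∀ ρ, ∀ a ∈ (dist ρ).support, Enabled Υ (History.last ρ) a

/-! ### The Markov chain on histories and its law -/

open Classical in
/-- The transition function of the Markov chain that a scheduler induces on histories. Actions
that are not enabled do not contribute to the sum, as the scheduler gives them weight zero. -/
noncomputable def chainProb {W : CFG} {Υ : Sampling W} (σ : Scheduler Υ) (ρ ρ' : History Υ) :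
    ℝ≥0∞ :=
  if ρ'.1 = ρ.1 ++ [History.last ρ'] then
    ∑ a, σ.dist ρ a * transProb Υ (History.last ρ) a (History.last ρ')
  else 0

theorem tsum_sampProb {W : CFG} (Υ : Sampling W) : ∑' μ, sampProb Υ μ = 1 := by
  have h := MeasureTheory.Measure.tsum_indicator_apply_singleton
    (MeasureTheory.Measure.pi fun r => (Υ r).toMeasure) Set.univ MeasurableSet.univ
  rw [MeasureTheory.measure_univ] at h
  rw [← h]
  refine tsum_congr fun μ => ?_
  simp [sampProb, MeasureTheory.Measure.pi_singleton, PMF.toMeasure_apply_singleton]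

theorem tsum_chainProb {W : CFG} {Υ : Sampling W} (σ : Scheduler Υ) (ρ : History Υ) :
    ∑' ρ', chainProb σ ρ ρ' = 1 := by
  classical
  have hinj : Function.Injective
      fun ρ' : {ρ' : History Υ // ρ'.1 = ρ.1 ++ [History.last ρ']} => History.last ρ'.1 := by
    rintro ⟨ρ₁, h₁⟩ ⟨ρ₂, h₂⟩ h
    apply Subtype.ext
    apply Subtype.ext
    change ρ₁.1 = ρ₂.1
    rw [h₁, h₂]
    simp only at h
    rw [h]
  have h1 : ∑' ρ', chainProb σ ρ ρ' =
      ∑' ρ' : {ρ' : History Υ // ρ'.1 = ρ.1 ++ [History.last ρ']},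
        ∑ a, σ.dist ρ a * transProb Υ (History.last ρ) a (History.last ρ'.1) := by
    have := tsum_subtype {ρ' : History Υ | ρ'.1 = ρ.1 ++ [History.last ρ']}
      (fun ρ' => ∑ a, σ.dist ρ a * transProb Υ (History.last ρ) a (History.last ρ'))
    refine Eq.trans (tsum_congr fun ρ' => ?_) this.symm
    simp [chainProb, Set.indicator]
  have h2 := hinj.tsum_eq
    (f := fun s => ∑ a, σ.dist ρ a * transProb Υ (History.last ρ) a s) (by
      intro s hs
      have hs' : ∃ a, 0 < transProb Υ (History.last ρ) a s := by
        by_contra hcon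
        push Not at hcon
        exact hs (Finset.sum_eq_zero fun a _ => by simp [le_antisymm (hcon a) bot_le])
      refine ⟨⟨⟨ρ.1 ++ [s], by simp, ?_⟩, by simp [History.last]⟩, by simp [History.last]⟩
      refine List.isChain_append.2 ⟨ρ.2.2, List.isChain_singleton _, ?_⟩
      intro x hx y hy
      simp only [List.head?_cons, Option.mem_def, Option.some.injEq] at hy
      subst hy
      rw [List.getLast?_eq_getLast_of_ne_nil ρ.2.1] at hx
      simp only [Option.mem_def, Option.some.injEq] at hx
      subst hx
      exact hs')
  rw [h1, h2, Summable.tsum_finsetSum (fun _ _ => ENNReal.summable)]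
  have h3 : ∀ a, ∑' s, σ.dist ρ a * transProb Υ (History.last ρ) a s = σ.dist ρ a := by
    intro a
    rw [ENNReal.tsum_mul_left]
    by_cases ha : σ.dist ρ a = 0
    · simp [ha]
    · rw [show ∑' s, transProb Υ (History.last ρ) a s = 1 from
        σ.enabled ρ a ((PMF.mem_support_iff _ _).2 ha), mul_one]
  simp_rw [h3]
  rw [← tsum_fintype (L := .unconditional _)]
  exact (σ.dist ρ).tsum_coe

/-- The one-step distribution of the Markov chain on histories. -/
noncomputable def chainStep {W : CFG} {Υ : Sampling W} (σ : Scheduler Υ) (ρ : History Υ) :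
    PMF (History Υ) :=
  ⟨chainProb σ ρ, by rw [← tsum_chainProb σ ρ]; exact ENNReal.summable.hasSum⟩

/-- Histories carry the discrete σ-algebra, sequences of histories the product σ-algebra. -/
instance {W : CFG} (Υ : Sampling W) : MeasurableSpace (History Υ) := ⊤

/-- The one-step kernel at time `n`; it only uses the history at time `n`. -/
noncomputable def chainKernel {W : CFG} {Υ : Sampling W} (σ : Scheduler Υ) (n : ℕ) :
    ProbabilityTheory.Kernel (Finset.Iic n → History Υ) (History Υ) where
  toFun x := (chainStep σ (x ⟨n, Finset.mem_Iic.2 le_rfl⟩)).toMeasure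
  measurable' := (measurable_from_top (f := fun ρ => (chainStep σ ρ).toMeasure)).comp
    (measurable_pi_apply _)

instance {W : CFG} {Υ : Sampling W} (σ : Scheduler Υ) (n : ℕ) :
    ProbabilityTheory.IsMarkovKernel (chainKernel σ n) :=
  ⟨fun x => by
    change MeasureTheory.IsProbabilityMeasure (chainStep σ _).toMeasure
    infer_instance⟩

/-- The initial history `(𝔠, 0)`, for the one-letter configuration `𝔠`. -/
def initHistory {W : CFG} (Υ : Sampling W) (c : NTElem W) : History Υ :=
  History.single Υ ([c], 0)

/-- The law of the Markov chain on histories for the scheduler `σ` and the initial stack element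
`c`. It lives on all sequences of histories and is concentrated on the infinite runs. -/
noncomputable def runLaw {W : CFG} {Υ : Sampling W} (σ : Scheduler Υ) (c : NTElem W) :
    MeasureTheory.Measure (ℕ → History Υ) :=
  ProbabilityTheory.Kernel.traj (X := fun _ => History Υ) (chainKernel σ) 0
    fun _ => initHistory Υ c

/-! ### Termination time -/

/-- The termination time: the first time at which the configuration is empty, `∞` if none. -/
noncomputable def termTime {W : CFG} {Υ : Sampling W} (ω : ℕ → History Υ) : ℝ≥0∞ :=
  ⨅ (n : ℕ) (_ : (History.last (ω n)).1 = []), (n : ℝ≥0∞)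

open Classical in
/-- `T̄`: the supremum over all schedulers of the expected termination time (`0` at terminal stack
elements). -/
noncomputable def Tbar {W : CFG} (Υ : Sampling W) (c : StackElem W) : ℝ≥0∞ :=
  if h : c.Terminal then 0
  else ⨆ σ : Scheduler Υ, MeasureTheory.lintegral (runLaw σ ⟨c, h⟩) termTime

/-! ### Ranking measure functions -/

open Classical in
/-- `h` is a ranking measure function with constant `ε`. In `ℝ≥0∞` one has `0 * ∞ = 0`, so the
sums range over the support of the sampling distribution. -/
structure IsRankingWith {W : CFG} (Υ : Sampling W) (h : StackElem W → ℝ≥0∞) (ε : ℝ≥0) :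
    Prop where
  pos : 0 < ε
  terminal : ∀ f ν, h ⟨f, W.lout f, ν⟩ = 0
  assign : ∀ f ℓ (hℓ : ℓ ≠ W.lout f) ν u ℓ', W.trans f ℓ hℓ = .assign u ℓ' →
    ε + ∑' μ, sampProb Υ μ * h ⟨f, ℓ', u ν μ⟩ ≤ h ⟨f, ℓ, ν⟩
  call : ∀ f ℓ (hℓ : ℓ ≠ W.lout f) ν g v ℓ', W.trans f ℓ hℓ = .call g v ℓ' →
    ε + h ⟨g, W.lin g, v ν⟩ + h ⟨f, ℓ', ν⟩ ≤ h ⟨f, ℓ, ν⟩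
  branch : ∀ f ℓ (hℓ : ℓ ≠ W.lout f) ν φ ℓ₁ ℓ₂, W.trans f ℓ hℓ = .branch φ ℓ₁ ℓ₂ →
    (if φ.Sat ν then h ⟨f, ℓ₁, ν⟩ else h ⟨f, ℓ₂, ν⟩) + ε ≤ h ⟨f, ℓ, ν⟩
  nondet : ∀ f ℓ (hℓ : ℓ ≠ W.lout f) ν ℓ₁ ℓ₂, W.trans f ℓ hℓ = .nondet ℓ₁ ℓ₂ →
    max (h ⟨f, ℓ₁, ν⟩) (h ⟨f, ℓ₂, ν⟩) + ε ≤ h ⟨f, ℓ, ν⟩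

/-- Ranking measure functions. -/
def IsRankingMeasureFunction {W : CFG} (Υ : Sampling W) (h : StackElem W → ℝ≥0∞) : Prop :=
  ∃ ε : ℝ≥0, IsRankingWith Υ h ε

/-- `|a - b|` in `[0, ∞]`; one of the two truncated differences is zero. -/
noncomputable def absDiff (a b : ℝ≥0∞) : ℝ≥0∞ := (a - b) + (b - a)

open Classical in
/-- `h` is a conditionally difference-bounded ranking measure function with constants `δ`, `ζ`. -/
structure IsCondDiffBoundedWith {W : CFG} (Υ : Sampling W) (h : StackElem W → ℝ≥0∞)
    (δ ζ : ℝ≥0) : Prop where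
  ranking : IsRankingMeasureFunction Υ h
  pos_left : 0 < δ
  pos_right : 0 < ζ
  assign : ∀ f ℓ (hℓ : ℓ ≠ W.lout f) ν u ℓ', W.trans f ℓ hℓ = .assign u ℓ' →
    h ⟨f, ℓ, ν⟩ < ∞ → h ⟨f, ℓ, ν⟩ ≤ δ + ∑' μ, sampProb Υ μ * h ⟨f, ℓ', u ν μ⟩
  assign_abs : ∀ f ℓ (hℓ : ℓ ≠ W.lout f) ν u ℓ', W.trans f ℓ hℓ = .assign u ℓ' →
    h ⟨f, ℓ, ν⟩ < ∞ → ∑' μ, sampProb Υ μ * absDiff (h ⟨f, ℓ', u ν μ⟩) (h ⟨f, ℓ, ν⟩) ≤ ζ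
  call : ∀ f ℓ (hℓ : ℓ ≠ W.lout f) ν g v ℓ', W.trans f ℓ hℓ = .call g v ℓ' →
    h ⟨f, ℓ, ν⟩ < ∞ → h ⟨f, ℓ, ν⟩ ≤ δ + h ⟨g, W.lin g, v ν⟩ + h ⟨f, ℓ', ν⟩
  branch : ∀ f ℓ (hℓ : ℓ ≠ W.lout f) ν φ ℓ₁ ℓ₂, W.trans f ℓ hℓ = .branch φ ℓ₁ ℓ₂ →
    h ⟨f, ℓ, ν⟩ < ∞ →
      h ⟨f, ℓ, ν⟩ ≤ (if φ.Sat ν then h ⟨f, ℓ₁, ν⟩ else h ⟨f, ℓ₂, ν⟩) + δ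
  nondet : ∀ f ℓ (hℓ : ℓ ≠ W.lout f) ν ℓ₁ ℓ₂, W.trans f ℓ hℓ = .nondet ℓ₁ ℓ₂ →
    h ⟨f, ℓ, ν⟩ < ∞ → h ⟨f, ℓ, ν⟩ ≤ max (h ⟨f, ℓ₁, ν⟩) (h ⟨f, ℓ₂, ν⟩) + δ

end RecProb

/-! Since `Tbar` is a supremum, one good scheduler suffices: the greedy one, which at a
nondeterministic label takes a branch with the larger value of `h`. Let X_n be the sum of `h` over
the stack at time n. Under this scheduler the ranking inequalities make E X_n non-increasing, and
the difference bound gives E X_n ≤ δ · P(alive at n) + E X_{n+1}. Telescoping yields h(c) ≤ δ ·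
∑_{k<n} P(alive at k) + E X_n (`weight_le_sum_alive`).

It remains to remove E X_n. If ∑ P(alive at k) = ∞, the expected termination time is infinite and
nothing is left to prove. Otherwise almost every run reaches the empty stack, where X = 0, so X_n is
at most the sum of |X_{k+1} - X_k| over k ≥ n. Each step has conditional mean absolute difference at
most δ + ζ while the run is alive and 0 afterwards, so E X_n is bounded by (δ + ζ) times the tail of
a convergent series (`lintegral_weight_le_tail`). Letting n → ∞ gives h(c) ≤ δ · ∑ P(alive at k) ≤ δ
· E T. -/

namespace RecProb

open MeasureTheory ProbabilityTheory Filter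

/-! ### Total weight of a configuration -/

/-- The sum of the values of `h` over the letters of a configuration. -/
noncomputable def weight {W : CFG} (h : StackElem W → ℝ≥0∞) (w : Config W) : ℝ≥0∞ :=
  (w.map fun c => h c.1).sum

@[simp]
theorem weight_nil {W : CFG} (h : StackElem W → ℝ≥0∞) : weight h [] = 0 := rfl

@[simp]
theorem weight_cons {W : CFG} (h : StackElem W → ℝ≥0∞) (c : NTElem W) (w : Config W) :
    weight h (c :: w) = h c.1 + weight h w := by
  simp [weight]

/-- Deleting terminal letters does not change the weight because `h` vanishes on them. -/
theorem weight_push {W : CFG} {h : StackElem W → ℝ≥0∞} (hterm : ∀ f ν, h ⟨f, W.lout f, ν⟩ = 0)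
    (c : StackElem W) (w : Config W) : weight h (push c w) = h c + weight h w := by
  unfold push
  split_ifs with hc
  · obtain ⟨f, ℓ, ν⟩ := c
    change ℓ = W.lout f at hc
    subst hc
    simp [hterm]
  · simp

/-- Only an inequality: for `r = ∞` the left side is 0 by truncation. -/
theorem absDiff_add_right_le (a b r : ℝ≥0∞) : absDiff (a + r) (b + r) ≤ absDiff a b :=
  add_le_add add_tsub_add_le_tsub_right add_tsub_add_le_tsub_right

theorem le_add_absDiff (a b : ℝ≥0∞) : b ≤ a + absDiff a b :=
  le_add_tsub.trans (add_le_add_right le_add_self a)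

theorem absDiff_le_of_le {a b δ : ℝ≥0∞} (hab : a ≤ b) (hba : b ≤ δ + a) : absDiff a b ≤ δ := by
  rw [absDiff, tsub_eq_zero_of_le hab, zero_add]
  exact tsub_le_iff_right.2 hba

/-! ### Greedy steps -/

/-- `G` describes a step from `w` under which the mean weight does not grow, drops by at most `δ`,
and has mean absolute difference at most `K`. -/
structure IsGreedyStep {W : CFG} (Υ : Sampling W) (h : StackElem W → ℝ≥0∞) (δ K : ℝ≥0∞)
    (w : Config W) (G : Val W.Vr → Config W) : Prop where
  tsum_le : ∑' μ, sampProb Υ μ * weight h (G μ) ≤ weight h w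
  le_tsum : weight h w < ∞ → weight h w ≤ δ + ∑' μ, sampProb Υ μ * weight h (G μ)
  absDiff_le : weight h w < ∞ →
    ∑' μ, sampProb Υ μ * absDiff (weight h (G μ)) (weight h w) ≤ K

/-- A step rewrites only the top letter. The rest of the stack adds the same constant before and
after, since the sampling probabilities sum to 1, so the conditions reduce to the top letter's
contribution `y`. -/
theorem isGreedyStep_cons {W : CFG} {Υ : Sampling W} {h : StackElem W → ℝ≥0∞} {δ K : ℝ≥0∞}
    {c : NTElem W} {w : Config W} {G : Val W.Vr → Config W} (y : Val W.Vr → ℝ≥0∞)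
    (hG : ∀ μ, weight h (G μ) = y μ + weight h w)
    (h₁ : ∑' μ, sampProb Υ μ * y μ ≤ h c.1)
    (h₂ : h c.1 < ∞ → h c.1 ≤ δ + ∑' μ, sampProb Υ μ * y μ)
    (h₃ : h c.1 < ∞ → ∑' μ, sampProb Υ μ * absDiff (y μ) (h c.1) ≤ K) :
    IsGreedyStep Υ h δ K (c :: w) G := by
  have key : ∑' μ, sampProb Υ μ * weight h (G μ) =
      ∑' μ, sampProb Υ μ * y μ + weight h w := by
    simp_rw [hG, mul_add]
    rw [ENNReal.tsum_add, ENNReal.tsum_mul_right, tsum_sampProb, one_mul]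
  refine ⟨?_, fun hw => ?_, fun hw => ?_⟩
  · rw [key, weight_cons]
    gcongr
  · rw [weight_cons] at hw ⊢
    rw [key, ← add_assoc]
    gcongr
    exact h₂ (lt_of_le_of_lt le_self_add hw)
  · rw [weight_cons] at hw
    refine le_trans (ENNReal.tsum_le_tsum fun μ => ?_) (h₃ (lt_of_le_of_lt le_self_add hw))
    rw [hG, weight_cons]
    gcongr
    exact absDiff_add_right_le _ _ _

theorem isGreedyStep_cons_const {W : CFG} {Υ : Sampling W} {h : StackElem W → ℝ≥0∞}
    {δ K : ℝ≥0∞} (hK : δ ≤ K) {c : NTElem W} {w w' : Config W} (y : ℝ≥0∞)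
    (hw' : weight h w' = y + weight h w) (h₁ : y ≤ h c.1) (h₂ : h c.1 < ∞ → h c.1 ≤ δ + y) :
    IsGreedyStep Υ h δ K (c :: w) fun _ => w' := by
  refine isGreedyStep_cons (fun _ => y) (fun _ => hw') ?_ ?_ fun hc => ?_ <;>
    rw [ENNReal.tsum_mul_right, tsum_sampProb, one_mul]
  · exact h₁
  · exact h₂
  · exact (absDiff_le_of_le h₁ (h₂ hc)).trans hK

/-- The constant `δ + ζ` covers both sources of variation: `ζ` for assignments, and `δ` for the
other labels, where the weight drops deterministically by at most `δ`. -/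
theorem exists_greedyStep {W : CFG} {Υ : Sampling W} {h : StackElem W → ℝ≥0∞} {δ ζ : ℝ≥0}
    (hh : IsCondDiffBoundedWith Υ h δ ζ) (w : Config W) :
    ∃ a G, next w a = some G ∧ (w = [] → G = fun _ => []) ∧
      (w ≠ [] → IsGreedyStep Υ h δ (δ + ζ) w G) := by
  obtain ⟨ε, hε⟩ := hh.ranking
  have hp := weight_push hε.terminal
  have hK : (δ : ℝ≥0∞) ≤ δ + ζ := le_self_add
  match w with
  | [] => exact ⟨.tau, fun _ => [], by simp [next], fun _ => rfl, fun hw => absurd rfl hw⟩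
  | ⟨⟨f, ℓ, ν⟩, hℓ⟩ :: w =>
    simp only [reduceCtorEq, false_imp_iff, ne_eq, not_false_eq_true, true_imp_iff, true_and]
    cases ht : W.trans f ℓ hℓ with
    | assign u ℓ' =>
      refine ⟨.tau, fun μ' => push ⟨f, ℓ', u ν μ'⟩ w, by simp only [next, ht], ?_⟩
      exact isGreedyStep_cons (fun μ => h ⟨f, ℓ', u ν μ⟩) (fun μ => hp _ _)
        (le_add_self.trans (hε.assign f ℓ hℓ ν u ℓ' ht)) (hh.assign f ℓ hℓ ν u ℓ' ht)
        fun hc => (hh.assign_abs f ℓ hℓ ν u ℓ' ht hc).trans le_add_self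
    | call g v ℓ' =>
      refine ⟨.tau, fun _ => push ⟨g, W.lin g, v ν⟩ (push ⟨f, ℓ', ν⟩ w),
        by simp only [next, ht], ?_⟩
      refine isGreedyStep_cons_const hK (h ⟨g, W.lin g, v ν⟩ + h ⟨f, ℓ', ν⟩) ?_ ?_ fun hc => ?_
      · rw [hp, hp, add_assoc]
      · refine le_trans ?_ (hε.call f ℓ hℓ ν g v ℓ' ht)
        rw [add_assoc]
        exact le_add_self
      · rw [← add_assoc]
        exact hh.call f ℓ hℓ ν g v ℓ' ht hc
    | branch φ ℓ₁ ℓ₂ =>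
      have e₁ := hε.branch f ℓ hℓ ν φ ℓ₁ ℓ₂ ht
      have e₂ := hh.branch f ℓ hℓ ν φ ℓ₁ ℓ₂ ht
      classical
      refine ⟨.tau, fun _ => push ⟨f, if φ.Sat ν then ℓ₁ else ℓ₂, ν⟩ w,
        by simp only [next, ht], ?_⟩
      refine isGreedyStep_cons_const hK _ (hp _ _) ?_ fun hc => ?_
      · split_ifs at e₁ ⊢ <;> exact le_self_add.trans e₁
      · rw [add_comm]
        split_ifs at e₂ ⊢ <;> exact e₂ hc
    | nondet ℓ₁ ℓ₂ =>
      have e₁ := hε.nondet f ℓ hℓ ν ℓ₁ ℓ₂ ht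
      have e₂ := hh.nondet f ℓ hℓ ν ℓ₁ ℓ₂ ht
      rcases le_total (h ⟨f, ℓ₂, ν⟩) (h ⟨f, ℓ₁, ν⟩) with hle | hle
      · refine ⟨.th, fun _ => push ⟨f, ℓ₁, ν⟩ w, by simp only [next, ht], ?_⟩
        rw [max_eq_left hle] at e₁ e₂
        refine isGreedyStep_cons_const hK _ (hp _ _) (le_self_add.trans e₁) fun hc => ?_
        rw [add_comm]
        exact e₂ hc
      · refine ⟨.el, fun _ => push ⟨f, ℓ₂, ν⟩ w, by simp only [next, ht], ?_⟩
        rw [max_eq_right hle] at e₁ e₂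
        refine isGreedyStep_cons_const hK _ (hp _ _) (le_self_add.trans e₁) fun hc => ?_
        rw [add_comm]
        exact e₂ hc

/-! ### One step of the Markov chain -/

/-- For each sampled `μ`, only the configuration `G μ` can contribute. -/
theorem tsum_transProb_mul {W : CFG} (Υ : Sampling W) {s : State W} {a : Act}
    {G : Val W.Vr → Config W} (hG : next s.1 a = some G) (ψ : Config W → ℝ≥0∞) :
    ∑' s' : State W, transProb Υ s a s' * ψ s'.1 = ∑' μ, sampProb Υ μ * ψ (G μ) := by
  classical
  rw [ENNReal.tsum_prod', ENNReal.tsum_comm]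
  refine tsum_congr fun μ => ?_
  rw [tsum_eq_single (G μ)]
  · simp [transProb, hG]
  · intro w hw
    simp [transProb, hG, hw]

theorem enabled_of_next_eq_some {W : CFG} (Υ : Sampling W) {s : State W} {a : Act}
    {G : Val W.Vr → Config W} (hG : next s.1 a = some G) : Enabled Υ s a := by
  have := tsum_transProb_mul Υ hG fun _ => 1
  simpa [Enabled, tsum_sampProb] using this

/-- A one-step extension of `ρ` is determined by its last state, and every state of non-zero weight
does extend `ρ` to a history. Hence the sum over histories can be reindexed by states. -/
theorem tsum_chainProb_mul {W : CFG} {Υ : Sampling W} (σ : Scheduler Υ) (ρ : History Υ)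
    (ψ : State W → ℝ≥0∞) :
    ∑' ρ', chainProb σ ρ ρ' * ψ (History.last ρ') =
      ∑' s, (∑ a, σ.dist ρ a * transProb Υ (History.last ρ) a s) * ψ s := by
  classical
  have hinj : Function.Injective
      fun ρ' : {ρ' : History Υ // ρ'.1 = ρ.1 ++ [History.last ρ']} => History.last ρ'.1 := by
    rintro ⟨ρ₁, h₁⟩ ⟨ρ₂, h₂⟩ h
    apply Subtype.ext
    apply Subtype.ext
    change ρ₁.1 = ρ₂.1
    rw [h₁, h₂]
    simp only at h
    rw [h]
  have h₁ : ∑' ρ', chainProb σ ρ ρ' * ψ (History.last ρ') =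
      ∑' ρ' : {ρ' : History Υ // ρ'.1 = ρ.1 ++ [History.last ρ']},
        (∑ a, σ.dist ρ a * transProb Υ (History.last ρ) a (History.last ρ'.1)) *
          ψ (History.last ρ'.1) := by
    have := tsum_subtype {ρ' : History Υ | ρ'.1 = ρ.1 ++ [History.last ρ']}
      (fun ρ' => (∑ a, σ.dist ρ a * transProb Υ (History.last ρ) a (History.last ρ')) *
        ψ (History.last ρ'))
    refine Eq.trans (tsum_congr fun ρ' => ?_) this.symm
    simp [chainProb, Set.indicator]
  rw [h₁]
  refine hinj.tsum_eq
    (f := fun s => (∑ a, σ.dist ρ a * transProb Υ (History.last ρ) a s) * ψ s) fun s hs => ?_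
  have hs' : ∃ a, 0 < transProb Υ (History.last ρ) a s := by
    by_contra! hcon
    refine hs ?_
    simp only
    rw [Finset.sum_eq_zero fun a _ => by simp [le_antisymm (hcon a) bot_le], zero_mul]
  refine ⟨⟨⟨ρ.1 ++ [s], by simp, ?_⟩, by simp [History.last]⟩, by simp [History.last]⟩
  refine List.isChain_append.2 ⟨ρ.2.2, List.isChain_singleton _, ?_⟩
  intro x hx y hy
  rw [List.getLast?_eq_getLast_of_ne_nil ρ.2.1] at hx
  simp only [List.head?_cons, Option.mem_def, Option.some.injEq] at hx hy
  subst hx hy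
  exact hs'

/-- The scheduler that always plays the action `a w` at the configuration `w`. -/
noncomputable def positional {W : CFG} (Υ : Sampling W) (a : Config W → Act)
    (G : Config W → Val W.Vr → Config W) (hG : ∀ w, next w (a w) = some (G w)) :
    Scheduler Υ where
  dist ρ := PMF.pure (a (History.last ρ).1)
  enabled ρ b hb := by
    rw [PMF.support_pure, Set.mem_singleton_iff] at hb
    subst hb
    exact enabled_of_next_eq_some Υ (hG _)

theorem tsum_chainProb_positional {W : CFG} (Υ : Sampling W) {a : Config W → Act}
    {G : Config W → Val W.Vr → Config W} (hG : ∀ w, next w (a w) = some (G w)) (ρ : History Υ)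
    (ψ : Config W → ℝ≥0∞) :
    ∑' ρ', chainProb (positional Υ a G hG) ρ ρ' * ψ (History.last ρ').1 =
      ∑' μ, sampProb Υ μ * ψ (G (History.last ρ).1 μ) := by
  classical
  rw [tsum_chainProb_mul _ ρ fun s => ψ s.1, ← tsum_transProb_mul Υ (hG _)]
  refine tsum_congr fun s => ?_
  congr 1
  rw [Finset.sum_eq_single (a (History.last ρ).1)]
  · simp [positional]
  · intro b _ hb
    simp [positional, hb]
  · simp

/-! ### Integrals over runs -/

/-- Countability makes every function of one or two histories measurable. -/
instance {W : CFG} : Countable (StackElem W) :=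
  Function.Injective.countable
    (f := fun c : StackElem W => (⟨c.fn, c.lb, c.val⟩ :
      (f : W.F) × (W.Label f × Val (W.PVar f))))
    (by
      rintro ⟨f, ℓ, ν⟩ ⟨f', ℓ', ν'⟩ h
      simp only [Sigma.mk.injEq] at h
      obtain ⟨rfl, h⟩ := h
      simp only [heq_eq_eq, Prod.mk.injEq] at h
      obtain ⟨rfl, rfl⟩ := h
      rfl)

instance {W : CFG} (Υ : Sampling W) : Countable (History Υ) :=
  inferInstanceAs (Countable {_l : List (State W) // _})

instance {W : CFG} (Υ : Sampling W) : DiscreteMeasurableSpace (History Υ) :=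
  ⟨fun _ => trivial⟩

/-- The Markov property: the integrand sees only the last two histories, and the kernel at time `n`
depends only on the history at time `n`. -/
theorem lintegral_runLaw_succ {W : CFG} {Υ : Sampling W} (σ : Scheduler Υ) (c : NTElem W) (n : ℕ)
    (φ : History Υ → History Υ → ℝ≥0∞) :
    ∫⁻ ω, φ (ω n) (ω (n + 1)) ∂runLaw σ c =
      ∫⁻ ω, ∑' ρ, chainProb σ (ω n) ρ * φ (ω n) ρ ∂runLaw σ c := by
  have hev : Measurable fun x : Finset.Iic n → History Υ => x ⟨n, Finset.mem_Iic.2 le_rfl⟩ :=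
    measurable_pi_apply _
  have hφ : Measurable (Function.uncurry φ) := Measurable.of_discrete
  have hf : Measurable fun p : (Finset.Iic n → History Υ) × History Υ =>
      φ (p.1 ⟨n, Finset.mem_Iic.2 le_rfl⟩) p.2 :=
    hφ.comp ((hev.comp measurable_fst).prodMk measurable_snd)
  have hg : Measurable fun ρ : History Υ => ∑' ρ', chainProb σ ρ ρ' * φ ρ ρ' :=
    Measurable.of_discrete
  have h₁ : ∫⁻ p, φ (p.1 ⟨n, Finset.mem_Iic.2 le_rfl⟩) p.2
      ∂((runLaw σ c).map fun ω => (Preorder.frestrictLe n ω, ω (n + 1))) =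
      ∫⁻ ω, φ (ω n) (ω (n + 1)) ∂runLaw σ c :=
    lintegral_map hf (by fun_prop)
  have h₂ : ∫⁻ x, ∑' ρ, chainProb σ (x ⟨n, Finset.mem_Iic.2 le_rfl⟩) ρ *
      φ (x ⟨n, Finset.mem_Iic.2 le_rfl⟩) ρ ∂((runLaw σ c).map (Preorder.frestrictLe n)) =
      ∫⁻ ω, ∑' ρ, chainProb σ (ω n) ρ * φ (ω n) ρ ∂runLaw σ c :=
    lintegral_map (hg.comp hev) (Preorder.measurable_frestrictLe n)
  -- The joint law of the path up to `n` and the next history is the composition-product of the path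
  -- law with the kernel.
  rw [← h₁, ← h₂, runLaw, ← Kernel.partialTraj_compProd_eq_map_traj (Nat.zero_le n),
    Kernel.traj_map_frestrictLe_apply, Measure.lintegral_compProd hf]
  refine lintegral_congr fun x => ?_
  rw [lintegral_countable']
  refine tsum_congr fun ρ => ?_
  rw [mul_comm]
  congr 1
  exact PMF.toMeasure_apply_singleton _ _ (measurableSet_singleton _)

theorem lintegral_runLaw_zero {W : CFG} {Υ : Sampling W} (σ : Scheduler Υ) (c : NTElem W)
    (φ : History Υ → ℝ≥0∞) :
    ∫⁻ ω, φ (ω 0) ∂runLaw σ c = φ (initHistory Υ c) := by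
  rw [runLaw, Kernel.lintegral_traj]
  · simp [Function.updateFinset]
  · exact (Measurable.of_discrete (f := φ)).comp (measurable_pi_apply 0)

/-! ### The greedy run -/

open Classical in
/-- The indicator of the non-empty configurations. -/
noncomputable def alive {W : CFG} (w : Config W) : ℝ≥0∞ := if w = [] then 0 else 1

/-- The configuration at time `n` of a run. -/
def configAt {W : CFG} {Υ : Sampling W} (n : ℕ) (ω : ℕ → History Υ) : Config W :=
  (History.last (ω n)).1

theorem measurable_comp_configAt {W : CFG} {Υ : Sampling W} (n : ℕ) (ψ : Config W → ℝ≥0∞) :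
    Measurable fun ω : ℕ → History Υ => ψ (configAt n ω) :=
  (Measurable.of_discrete (f := fun ρ : History Υ => ψ (History.last ρ).1)).comp
    (measurable_pi_apply n)

theorem measurable_comp_configAt_succ {W : CFG} {Υ : Sampling W} (n : ℕ)
    (ψ : Config W → Config W → ℝ≥0∞) :
    Measurable fun ω : ℕ → History Υ => ψ (configAt n ω) (configAt (n + 1) ω) :=
  have hf : Measurable fun p : History Υ × History Υ =>
      ψ (History.last p.1).1 (History.last p.2).1 := Measurable.of_discrete
  have hp : Measurable fun ω : ℕ → History Υ => (ω n, ω (n + 1)) := by fun_prop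
  hf.comp hp

/-- If the empty configuration is absorbing along `ω`, the termination time is at least the number
of times at which the configuration is not empty. -/
theorem tsum_alive_le_termTime {W : CFG} {Υ : Sampling W} {ω : ℕ → History Υ}
    (hω : ∀ n, configAt n ω = [] → configAt (n + 1) ω = []) :
    ∑' n, alive (configAt n ω) ≤ termTime ω := by
  refine le_iInf₂ fun n hn => ?_
  have hdead : ∀ k, n ≤ k → configAt k ω = [] := fun k hk => by
    induction k, hk using Nat.le_induction with
    | base => exact hn
    | succ k _ ih => exact hω k ih
  rw [tsum_eq_sum (s := Finset.range n) fun k hk => by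
    simp [alive, hdead k (by simpa using hk)]]
  calc ∑ k ∈ Finset.range n, alive (configAt k ω) ≤ ∑ k ∈ Finset.range n, 1 :=
        Finset.sum_le_sum fun k _ => by unfold alive; split_ifs <;> simp
    _ = n := by simp

/-- One-sided telescoping from 0 to `N`, which avoids subtraction in `ℝ≥0∞`. -/
theorem le_tsum_absDiff (x : ℕ → ℝ≥0∞) {N : ℕ} (hN : x N = 0) :
    x 0 ≤ ∑' k, absDiff (x (k + 1)) (x k) := by
  have key : ∀ n, x 0 ≤ x n + ∑ k ∈ Finset.range n, absDiff (x (k + 1)) (x k) := fun n => by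
    induction n with
    | zero => simp
    | succ n ih =>
      rw [Finset.sum_range_succ]
      calc x 0 ≤ x n + ∑ k ∈ Finset.range n, absDiff (x (k + 1)) (x k) := ih
        _ ≤ x (n + 1) + absDiff (x (n + 1)) (x n) +
            ∑ k ∈ Finset.range n, absDiff (x (k + 1)) (x k) := by
          gcongr
          exact le_add_absDiff _ _
        _ = _ := by rw [add_assoc, add_comm (absDiff _ _)]
  have := key N
  rw [hN, zero_add] at this
  exact this.trans (ENNReal.sum_le_tsum _)

/-! ### Expected weight under a positional scheduler -/

section Positional

variable {W : CFG} {Υ : Sampling W} {a : Config W → Act} {G : Config W → Val W.Vr → Config W}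
  (hG : ∀ w, next w (a w) = some (G w)) (c : NTElem W)

theorem lintegral_configAt_succ (n : ℕ) (ψ : Config W → Config W → ℝ≥0∞) :
    ∫⁻ ω, ψ (configAt n ω) (configAt (n + 1) ω) ∂runLaw (positional Υ a G hG) c =
      ∫⁻ ω, ∑' μ, sampProb Υ μ * ψ (configAt n ω) (G (configAt n ω) μ)
        ∂runLaw (positional Υ a G hG) c := by
  refine (lintegral_runLaw_succ _ c n fun ρ ρ' => ψ (History.last ρ).1 (History.last ρ').1).trans
    (lintegral_congr fun ω => ?_)
  exact tsum_chainProb_positional Υ hG (ω n) (ψ (configAt n ω))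

/-- Holds only almost surely, as `runLaw` lives on all sequences of histories. The indicator `ψ` of
a passage from empty to non-empty has one-step mean 0. -/
theorem ae_configAt_absorbing (hnil : G [] = fun _ => []) :
    ∀ᵐ ω ∂runLaw (positional Υ a G hG) c,
      ∀ n, configAt n ω = [] → configAt (n + 1) ω = [] := by
  classical
  refine ae_all_iff.2 fun n => ?_
  let ψ : Config W → Config W → ℝ≥0∞ := fun w w' => if w = [] then alive w' else 0
  have h₀ := lintegral_configAt_succ (Υ := Υ) hG c n ψ
  have h₁ : ∀ w, ∑' μ, sampProb Υ μ * ψ w (G w μ) = 0 := fun w => by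
    refine ENNReal.tsum_eq_zero.2 fun μ => ?_
    by_cases hw : w = []
    · subst hw
      simp [ψ, hnil, alive]
    · simp [ψ, hw]
  simp only [h₁, lintegral_zero] at h₀
  rw [lintegral_eq_zero_iff (measurable_comp_configAt_succ n ψ)] at h₀
  filter_upwards [h₀] with ω hω hn
  by_contra hne
  simp [ψ, hn, alive, hne] at hω

theorem tsum_lintegral_alive_le (hnil : G [] = fun _ => []) :
    ∑' n, ∫⁻ ω, alive (configAt n ω) ∂runLaw (positional Υ a G hG) c ≤
      ∫⁻ ω, termTime ω ∂runLaw (positional Υ a G hG) c := by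
  rw [← lintegral_tsum fun n => (measurable_comp_configAt n alive).aemeasurable]
  refine lintegral_mono_ae ?_
  filter_upwards [ae_configAt_absorbing hG c hnil] with ω hω
  exact tsum_alive_le_termTime hω

theorem lintegral_weight_zero (h : StackElem W → ℝ≥0∞) :
    ∫⁻ ω, weight h (configAt 0 ω) ∂runLaw (positional Υ a G hG) c = h c.1 := by
  refine (lintegral_runLaw_zero _ c fun ρ => weight h (History.last ρ).1).trans ?_
  simp [initHistory, History.single, History.last]

variable {h : StackElem W → ℝ≥0∞} {δ K : ℝ≥0∞} (hnil : G [] = fun _ => [])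
  (hstep : ∀ w, w ≠ [] → IsGreedyStep Υ h δ K w (G w))
include hnil hstep

theorem lintegral_weight_succ_le (n : ℕ) :
    ∫⁻ ω, weight h (configAt (n + 1) ω) ∂runLaw (positional Υ a G hG) c ≤
      ∫⁻ ω, weight h (configAt n ω) ∂runLaw (positional Υ a G hG) c := by
  rw [lintegral_configAt_succ hG c n fun _ w => weight h w]
  refine lintegral_mono fun ω => ?_
  by_cases hw : configAt n ω = []
  · simp [hw, hnil]
  · exact (hstep _ hw).tsum_le

/-- The lower bounds in `IsGreedyStep` assume finite weight; this holds almost surely because the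
mean weight never exceeds `h c.1`. -/
theorem ae_weight_lt_top (hc : h c.1 < ∞) (n : ℕ) :
    ∀ᵐ ω ∂runLaw (positional Υ a G hG) c, weight h (configAt n ω) < ∞ := by
  refine ae_lt_top (measurable_comp_configAt n _) (ne_top_of_le_ne_top hc.ne ?_)
  induction n with
  | zero => exact (lintegral_weight_zero hG c h).le
  | succ n ih => exact (lintegral_weight_succ_le hG c hnil hstep n).trans ih

theorem lintegral_weight_le_succ (hc : h c.1 < ∞) (n : ℕ) :
    ∫⁻ ω, weight h (configAt n ω) ∂runLaw (positional Υ a G hG) c ≤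
      δ * ∫⁻ ω, alive (configAt n ω) ∂runLaw (positional Υ a G hG) c +
        ∫⁻ ω, weight h (configAt (n + 1) ω) ∂runLaw (positional Υ a G hG) c := by
  rw [lintegral_configAt_succ hG c n fun _ w => weight h w,
    ← lintegral_const_mul _ (measurable_comp_configAt n alive),
    ← lintegral_add_left ((measurable_comp_configAt n alive).const_mul δ)]
  refine lintegral_mono_ae ?_
  filter_upwards [ae_weight_lt_top hG c hnil hstep hc n] with ω hω
  by_cases hw : configAt n ω = []
  · simp [hw]
  · simpa [alive, hw] using (hstep _ hw).le_tsum hω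

theorem lintegral_absDiff_weight_le (hc : h c.1 < ∞) (n : ℕ) :
    ∫⁻ ω, absDiff (weight h (configAt (n + 1) ω)) (weight h (configAt n ω))
      ∂runLaw (positional Υ a G hG) c ≤
      K * ∫⁻ ω, alive (configAt n ω) ∂runLaw (positional Υ a G hG) c := by
  rw [lintegral_configAt_succ hG c n fun w w' => absDiff (weight h w') (weight h w),
    ← lintegral_const_mul _ (measurable_comp_configAt n alive)]
  refine lintegral_mono_ae ?_
  filter_upwards [ae_weight_lt_top hG c hnil hstep hc n] with ω hω
  by_cases hw : configAt n ω = []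
  · simp [hw, hnil, absDiff]
  · simpa [alive, hw] using (hstep _ hw).absDiff_le hω

theorem weight_le_sum_alive (hc : h c.1 < ∞) (n : ℕ) :
    h c.1 ≤ δ * ∑ k ∈ Finset.range n,
        ∫⁻ ω, alive (configAt k ω) ∂runLaw (positional Υ a G hG) c +
      ∫⁻ ω, weight h (configAt n ω) ∂runLaw (positional Υ a G hG) c := by
  induction n with
  | zero => simp [lintegral_weight_zero hG c h]
  | succ n ih =>
    refine ih.trans ?_
    rw [Finset.sum_range_succ, mul_add, add_assoc]
    gcongr
    exact lintegral_weight_le_succ hG c hnil hstep hc n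

/-- This replaces an optional stopping argument: the remaining weight must be used up before the run
dies, and each further step while alive accounts for at most `K` of it on average. -/
theorem lintegral_weight_le_tail (hc : h c.1 < ∞)
    (hfin : ∑' k, ∫⁻ ω, alive (configAt k ω) ∂runLaw (positional Υ a G hG) c ≠ ∞) (n : ℕ) :
    ∫⁻ ω, weight h (configAt n ω) ∂runLaw (positional Υ a G hG) c ≤
      K * ∑' k, ∫⁻ ω, alive (configAt (k + n) ω) ∂runLaw (positional Υ a G hG) c := by
  have hm := fun k => measurable_comp_configAt (Υ := Υ) k alive
  rw [← lintegral_tsum fun k => (hm k).aemeasurable] at hfin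
  calc ∫⁻ ω, weight h (configAt n ω) ∂runLaw (positional Υ a G hG) c
      ≤ ∫⁻ ω, ∑' k, absDiff (weight h (configAt (k + n + 1) ω)) (weight h (configAt (k + n) ω))
          ∂runLaw (positional Υ a G hG) c := by
        refine lintegral_mono_ae ?_
        filter_upwards [ae_lt_top (Measurable.tsum hm) hfin] with ω hω
        -- A convergent series has terms below 1 eventually, and `alive` takes only the values 0 and
        -- 1, so the run is dead at some time `N + n`.
        have hlim := (tendsto_add_atTop_iff_nat n).2 (ENNReal.tendsto_atTop_zero_of_tsum_ne_top hω.ne)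
        obtain ⟨N, hN⟩ := (hlim.eventually_lt_const zero_lt_one).exists
        have hdead : configAt (N + n) ω = [] := by
          by_contra hne
          simp [alive, hne] at hN
        have := le_tsum_absDiff (fun k => weight h (configAt (k + n) ω)) (N := N) (by simp [hdead])
        simpa [add_right_comm _ 1 n] using this
    _ = ∑' k, ∫⁻ ω, absDiff (weight h (configAt (k + n + 1) ω)) (weight h (configAt (k + n) ω))
          ∂runLaw (positional Υ a G hG) c :=
        lintegral_tsum fun k => (measurable_comp_configAt_succ (k + n) fun w w' =>
          absDiff (weight h w') (weight h w)).aemeasurable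
    _ ≤ ∑' k, K * ∫⁻ ω, alive (configAt (k + n) ω) ∂runLaw (positional Υ a G hG) c :=
        ENNReal.tsum_le_tsum fun k => lintegral_absDiff_weight_le hG c hnil hstep hc (k + n)
    _ = _ := ENNReal.tsum_mul_left

theorem le_mul_tsum_alive (hc : h c.1 < ∞) (hK : K ≠ ∞)
    (hfin : ∑' k, ∫⁻ ω, alive (configAt k ω) ∂runLaw (positional Υ a G hG) c ≠ ∞) :
    h c.1 ≤ δ * ∑' k, ∫⁻ ω, alive (configAt k ω) ∂runLaw (positional Υ a G hG) c := by
  -- Multiplying the vanishing tail by `K` preserves the limit 0 because `K ≠ ∞`.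
  have hlim := (ENNReal.Tendsto.const_mul (ENNReal.tendsto_sum_nat_add _ hfin)
    (Or.inr hK)).const_add
    (δ * ∑' k, ∫⁻ ω, alive (configAt k ω) ∂runLaw (positional Υ a G hG) c)
  rw [mul_zero, add_zero] at hlim
  refine ge_of_tendsto' hlim fun n => (weight_le_sum_alive hG c hnil hstep hc n).trans ?_
  gcongr
  · exact ENNReal.sum_le_tsum _
  · exact lintegral_weight_le_tail hG c hnil hstep hc hfin n

end Positional

end RecProb

/-! ### The lower bound on the expected termination time -/

theorem mainTheorem6 (W : RecProb.CFG) (Υ : RecProb.Sampling W)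
    (h : RecProb.StackElem W → ℝ≥0∞) (δ ζ : ℝ≥0)
    (hh : RecProb.IsCondDiffBoundedWith Υ h δ ζ)
    (c : RecProb.StackElem W) (hc : h c < ∞) :
    h c / (δ : ℝ≥0∞) ≤ RecProb.Tbar Υ c := by
  by_cases ht : c.Terminal
  · obtain ⟨ε, hε⟩ := hh.ranking
    obtain ⟨f, ℓ, ν⟩ := c
    change ℓ = W.lout f at ht
    subst ht
    simp [hε.terminal]
  · choose a G hG hnil hstep using RecProb.exists_greedyStep hh
    have hT := RecProb.tsum_lintegral_alive_le (Υ := Υ) hG ⟨c, ht⟩ (hnil [] rfl)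
    rw [RecProb.Tbar, dif_neg ht]
    refine le_trans ?_ (le_iSup_of_le (RecProb.positional Υ a G hG) hT)
    -- The tail argument needs a convergent series; if it diverges, the right-hand side is `∞`.
    by_cases hfin : ∑' k, MeasureTheory.lintegral
        (RecProb.runLaw (RecProb.positional Υ a G hG) ⟨c, ht⟩)
        (fun ω => RecProb.alive (RecProb.configAt k ω)) = ∞
    · rw [hfin]
      exact le_top
    · exact ENNReal.div_le_of_le_mul' (RecProb.le_mul_tsum_alive hG ⟨c, ht⟩ (hnil [] rfl) hstep hc
        (ENNReal.add_ne_top.2 ⟨ENNReal.coe_ne_top, ENNReal.coe_ne_top⟩) hfin)
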